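/- Let $A\in\mathbb R^{n\times n}$ be nonsingular, $B\in\mathbb R^{n\times m}$ with $(A,B)$ controllable, $Q\ge 0$ and $R>0$ symmetric real matrices with $(Q^{1/2},A)$ observable. A gain $K\in\mathbb R^{m\times n}$ is called stabilizing if $I+BK$ is invertible and $(I+BK)^{-1}A$ is Hurwitz, i.e. if the derivative feedback $u=-K\dot x$ stabilizes $\dot x=Ax+Bu$. Let $x$ be a solution of $\dot x=Ax+Bu$ on $[0,NT]$, $T>0$, for some square-integrable input $u$, and let $\bar x=x+x_{\rm b}$ be the state measured with an unknown constant bias $x_{\rm b}\in\mathbb R^n$. Let $\Delta_{\kappa}$, $\Delta_x$, $I_{xx}$, $I_{xu}$ be the matrices whose $j$-th rows, $j=1,\dots,N$, are $$\big[\bar x\otimes\bar x\big]_{(j-1)T}^{jT}{}^{\rm T},\qquad \big[\bar x\big]_{(j-1)T}^{jT}{}^{\rm T},\qquad \int_{(j-1)T}^{jT}\dot x^{\rm T}\otimes\dot x^{\rm T}\,d\tau,\qquad \int_{(j-1)T}^{jT}\dot x^{\rm T}\otimes u^{\rm T}\,d\tau,$$ let $D_n$ be the duplication matrix ($\operatorname{vec}(P)=D_n\operatorname{vech}(P)$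 for symmetric $P\in\mathbb R^{n\times n}$, where $\operatorname{vech}(P)$ lists the $n(n+1)/2$ independent entries), and for a gain $K$ put $$X(K)=\big[\Delta_{\kappa}D_n,\ \Delta_x,\ -2I_{xx}(I_n\otimes K^{\rm T}R)-2I_{xu}(I_n\otimes R)\big],\qquad Y(K)=-I_{xx}\operatorname{vec}(Q+K^{\rm T}RK).$$ Define a symmetric matrix $\hat P(K)$, a vector $\hat\epsilon(K)$ and a gain $\hat K^{+}(K)$ by $$\begin{bmatrix}\operatorname{vech}(\hat P)\\ \hat\epsilon\\ \operatorname{vec}(\hat K^{+})\end{bmatrix}=\big(X(K)^{\rm T}X(K)\big)^{-1}X(K)^{\rm T}Y(K).$$ (a) If $X(K)$ has full column rank, then $P=\hat P(K)$ and $K'=\hat K^{+}(K)$ are the unique solution, with $P$ symmetric, of the model-based policy-iteration equations $$P F+F^{\rm T}P+Q+K^{\rm T}RK=0,\quad F=A^{-1}(I+BK),\qquad K'=-R^{-1}B^{\rm T}(A^{-1})^{\rm T}P,$$ and $\hat\epsilon(K)=-2\hat P(K)x_{\rm b}$. If moreover $K$ is stabilizing, then $\hat P(K)$ is positive definite. (b)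 Let $K_1$ be stabilizing and set $\hat K_1=K_1$, $\hat P_i=\hat P(\hat K_i)$, $\hat K_{i+1}=\hat K^{+}(\hat K_i)$ for $i\ge1$. If $X_i=X(\hat K_i)$ has full column rank for every $i\ge 1$, then every $\hat K_i$ is stabilizing, the algebraic Riccati equation $$P A^{-1}+(A^{-1})^{\rm T}P-PA^{-1}BR^{-1}B^{\rm T}(A^{-1})^{\rm T}P+Q=0$$ has exactly one positive definite solution $P^*$, and, as $i\to\infty$, $\hat P_i\to P^*$ and $\hat K_i\to K^*=-R^{-1}B^{\rm T}(A^{-1})^{\rm T}P^*$. -/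

import Mathlib

open Matrix MeasureTheory Filter Topology
open scoped Kronecker

noncomputable section

namespace DFC

/-! ### Linear systems -/

/-- Kalman controllability of `(A, B)`: the matrix `[B, AB, …, A^(n-1) B]` has rank `n`. -/
def Controllable {n m : ℕ} (A : Matrix (Fin n) (Fin n) ℝ) (B : Matrix (Fin n) (Fin m) ℝ) : Prop :=
  (Matrix.of fun (a : Fin n) (q : Fin n × Fin m) => (A ^ (q.1 : ℕ) * B) a q.2).rank = n

/-- Kalman observability of `(C, A)`: the matrix with row blocks `C, CA, …, C A^(n-1)` has
rank `n`. -/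
def Observable {n l : ℕ} (C : Matrix (Fin l) (Fin n) ℝ) (A : Matrix (Fin n) (Fin n) ℝ) : Prop :=
  (Matrix.of fun (q : Fin n × Fin l) (a : Fin n) => (C * A ^ (q.1 : ℕ)) q.2 a).rank = n

section Sqrt

open scoped MatrixOrder

/-- The positive semidefinite square root `Q^{1/2}` of a positive semidefinite matrix. -/
def psdSqrt {n : ℕ} (Q : Matrix (Fin n) (Fin n) ℝ) : Matrix (Fin n) (Fin n) ℝ := CFC.sqrt Q

end Sqrt

/-- All complex eigenvalues have negative real part. -/
def Hurwitz {n : ℕ} (M : Matrix (Fin n) (Fin n) ℝ) : Prop :=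
  ∀ z ∈ spectrum ℂ (M.map (fun r : ℝ => (r : ℂ))), z.re < 0

/-- The derivative feedback `u = -K ẋ` stabilizes `ẋ = A x + B u`: the closed loop
`(I + B K) ẋ = A x` can be solved for `ẋ`, and `(I + B K)⁻¹ A` is Hurwitz. -/
def Stabilizing {n m : ℕ} (A : Matrix (Fin n) (Fin n) ℝ) (B : Matrix (Fin n) (Fin m) ℝ)
    (K : Matrix (Fin m) (Fin n) ℝ) : Prop :=
  IsUnit (1 + B * K).det ∧ Hurwitz ((1 + B * K)⁻¹ * A)

/-- `x` is a (Carathéodory) solution of `ẋ = A x + B u` on `[0, τ]` for a square integrable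
input `u`. Classical solutions with continuous or piecewise continuous `u` are included. -/
structure IsTrajectory {n m : ℕ} (A : Matrix (Fin n) (Fin n) ℝ) (B : Matrix (Fin n) (Fin m) ℝ)
    (τ : ℝ) (x : ℝ → Fin n → ℝ) (u : ℝ → Fin m → ℝ) : Prop where
  input_memLp : MemLp u 2 (volume.restrict (Set.Icc 0 τ))
  absCont : AbsolutelyContinuousOnInterval x 0 τ
  hasDerivAt : ∀ᵐ t ∂volume.restrict (Set.Icc 0 τ), HasDerivAt x (A *ᵥ x t + B *ᵥ u t) t

/-! ### The Riccati equation and model-based policy iteration -/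

/-- `P A⁻¹ + A⁻ᵀ P - P A⁻¹ B R⁻¹ Bᵀ A⁻ᵀ P + Q = 0`. -/
def SolvesARE {n m : ℕ} (A : Matrix (Fin n) (Fin n) ℝ) (B : Matrix (Fin n) (Fin m) ℝ)
    (Q : Matrix (Fin n) (Fin n) ℝ) (R : Matrix (Fin m) (Fin m) ℝ)
    (P : Matrix (Fin n) (Fin n) ℝ) : Prop :=
  P * A⁻¹ + A⁻¹ᵀ * P - P * A⁻¹ * B * R⁻¹ * Bᵀ * A⁻¹ᵀ * P + Q = 0

/-- Policy evaluation of the gain `K`: `P F + Fᵀ P + Q + Kᵀ R K = 0` with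
`F = A⁻¹ (I + B K)`. -/
def SolvesEvaluation {n m : ℕ} (A : Matrix (Fin n) (Fin n) ℝ) (B : Matrix (Fin n) (Fin m) ℝ)
    (Q : Matrix (Fin n) (Fin n) ℝ) (R : Matrix (Fin m) (Fin m) ℝ)
    (K : Matrix (Fin m) (Fin n) ℝ) (P : Matrix (Fin n) (Fin n) ℝ) : Prop :=
  P * (A⁻¹ * (1 + B * K)) + (A⁻¹ * (1 + B * K))ᵀ * P + Q + Kᵀ * R * K = 0

/-- The gain `-R⁻¹ Bᵀ A⁻ᵀ P` belonging to `P`. -/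
def gainOf {n m : ℕ} (A : Matrix (Fin n) (Fin n) ℝ) (B : Matrix (Fin n) (Fin m) ℝ)
    (R : Matrix (Fin m) (Fin m) ℝ) (P : Matrix (Fin n) (Fin n) ℝ) : Matrix (Fin m) (Fin n) ℝ :=
  -(R⁻¹ * Bᵀ * A⁻¹ᵀ * P)

/-! ### Data-driven policy iteration -/

/-- The signals available to the data-driven method: `N` windows of length `T`, the state
derivative `dx`, the biased state `xbar` and the input `u`. -/
structure Data (n m : ℕ) where
  N : ℕ
  T : ℝ
  dx : ℝ → Fin n → ℝ
  xbar : ℝ → Fin n → ℝ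
  u : ℝ → Fin m → ℝ

/-- The data recorded along a state trajectory `x` with input `u` when the state measurement has
the constant bias `xb`. -/
def measure {n m : ℕ} (N : ℕ) (T : ℝ) (x : ℝ → Fin n → ℝ) (u : ℝ → Fin m → ℝ)
    (xb : Fin n → ℝ) : Data n m where
  N := N
  T := T
  dx := deriv x
  xbar := fun t => x t + xb
  u := u

namespace Data

variable {n m : ℕ} (d : Data n m)

/-- Row `j` is `∫ ẋᵀ ⊗ ẋᵀ` over the window `[jT, (j+1)T]`. -/
def Ixx : Matrix (Fin d.N) (Fin n × Fin n) ℝ :=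
  Matrix.of fun j q => ∫ t in (j * d.T)..((j + 1) * d.T), d.dx t q.1 * d.dx t q.2

/-- Row `j` is `∫ ẋᵀ ⊗ uᵀ` over the window `[jT, (j+1)T]`. -/
def Ixu : Matrix (Fin d.N) (Fin n × Fin m) ℝ :=
  Matrix.of fun j q => ∫ t in (j * d.T)..((j + 1) * d.T), d.dx t q.1 * d.u t q.2

/-- The quadratic basis `x̄ ⊗ x̄`. -/
def xkappa (t : ℝ) : Fin n × Fin n → ℝ := fun q => d.xbar t q.1 * d.xbar t q.2

/-- Row `j` is the increment of `x̄ ⊗ x̄` over the window `[jT, (j+1)T]`. -/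
def deltaKappa : Matrix (Fin d.N) (Fin n × Fin n) ℝ :=
  Matrix.of fun j q => d.xkappa ((j + 1) * d.T) q - d.xkappa (j * d.T) q

/-- Row `j` is the increment of `x̄` over the window `[jT, (j+1)T]`. -/
def deltaX : Matrix (Fin d.N) (Fin n) ℝ :=
  Matrix.of fun j a => d.xbar ((j + 1) * d.T) a - d.xbar (j * d.T) a

end Data

/-- The duplication matrix: it sends the `n (n + 1) / 2` independent entries of a symmetric matrix,
indexed by unordered pairs, to the full vector of its entries. -/
def duplication (n : ℕ) : Matrix (Fin n × Fin n) (Sym2 (Fin n)) ℝ :=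
  Matrix.of fun q s => if s(q.1, q.2) = s then 1 else 0

/-- The unknowns: the independent entries of the symmetric matrix `P`, the vector `ε` and the
entries of the next gain; `n (n + 1) / 2 + n + n m` in number. -/
abbrev Unknown (n m : ℕ) : Type := Sym2 (Fin n) ⊕ (Fin n ⊕ (Fin n × Fin m))

namespace Data

variable {n m : ℕ} (d : Data n m)

/-- The data matrix of the gain `K`. The matrix of increments of `x̄ ⊗ x̄` is multiplied by the
duplication matrix, since `x̄ ⊗ x̄` lists every mixed monomial twice. -/
def dataMatrix (R : Matrix (Fin m) (Fin m) ℝ) (K : Matrix (Fin m) (Fin n) ℝ) :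
    Matrix (Fin d.N) (Unknown n m) ℝ :=
  Matrix.fromCols (d.deltaKappa * duplication n)
    (Matrix.fromCols d.deltaX
      (-(2 : ℝ) • (d.Ixx * ((1 : Matrix (Fin n) (Fin n) ℝ) ⊗ₖ (Kᵀ * R)))
        - (2 : ℝ) • (d.Ixu * ((1 : Matrix (Fin n) (Fin n) ℝ) ⊗ₖ R))))

/-- The right-hand side `-I_xx vec(Q + Kᵀ R K)`. -/
def rhs (Q : Matrix (Fin n) (Fin n) ℝ) (R : Matrix (Fin m) (Fin m) ℝ)
    (K : Matrix (Fin m) (Fin n) ℝ) : Fin d.N → ℝ :=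
  -(d.Ixx *ᵥ Matrix.vec (Q + Kᵀ * R * K))

/-- The data matrix of the gain `K` has full column rank. -/
def FullColumnRank (R : Matrix (Fin m) (Fin m) ℝ) (K : Matrix (Fin m) (Fin n) ℝ) : Prop :=
  (d.dataMatrix R K).rank = Fintype.card (Unknown n m)

/-- The least-squares solution `(XᵀX)⁻¹ Xᵀ Y`. -/
def leastSquares (Q : Matrix (Fin n) (Fin n) ℝ) (R : Matrix (Fin m) (Fin m) ℝ)
    (K : Matrix (Fin m) (Fin n) ℝ) : Unknown n m → ℝ :=
  (((d.dataMatrix R K)ᵀ * d.dataMatrix R K)⁻¹ * (d.dataMatrix R K)ᵀ) *ᵥ d.rhs Q R K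

/-- The symmetric matrix read off from the least-squares solution. -/
def Phat (Q : Matrix (Fin n) (Fin n) ℝ) (R : Matrix (Fin m) (Fin m) ℝ)
    (K : Matrix (Fin m) (Fin n) ℝ) : Matrix (Fin n) (Fin n) ℝ :=
  Matrix.of fun a b => d.leastSquares Q R K (Sum.inl s(a, b))

/-- The bias parameter read off from the least-squares solution. -/
def epsHat (Q : Matrix (Fin n) (Fin n) ℝ) (R : Matrix (Fin m) (Fin m) ℝ)
    (K : Matrix (Fin m) (Fin n) ℝ) : Fin n → ℝ :=
  fun a => d.leastSquares Q R K (Sum.inr (Sum.inl a))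

/-- The next gain read off from the least-squares solution (its entries are stacked
column by column). -/
def Khat (Q : Matrix (Fin n) (Fin n) ℝ) (R : Matrix (Fin m) (Fin m) ℝ)
    (K : Matrix (Fin m) (Fin n) ℝ) : Matrix (Fin m) (Fin n) ℝ :=
  Matrix.of fun c a => d.leastSquares Q R K (Sum.inr (Sum.inr (a, c)))

/-- The data-driven gains, started at `K₁`; `gainSeq i` is the gain with number `i + 1`. -/
def gainSeq (Q : Matrix (Fin n) (Fin n) ℝ) (R : Matrix (Fin m) (Fin m) ℝ)
    (K₁ : Matrix (Fin m) (Fin n) ℝ) : ℕ → Matrix (Fin m) (Fin n) ℝ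
  | 0 => K₁
  | i + 1 => d.Khat Q R (gainSeq Q R K₁ i)

/-- The data-driven value matrices; `valueSeq i` is the value matrix with number `i + 1`. -/
def valueSeq (Q : Matrix (Fin n) (Fin n) ℝ) (R : Matrix (Fin m) (Fin m) ℝ)
    (K₁ : Matrix (Fin m) (Fin n) ℝ) (i : ℕ) : Matrix (Fin n) (Fin n) ℝ :=
  d.Phat Q R (d.gainSeq Q R K₁ i)

end Data

end DFC

end

/-! Under `u = -K ẋ` the closed loop reads `x = F ẋ` with `F = A⁻¹(1 + BK)`, so `F` is the inverse
of the closed-loop matrix and is Hurwitz exactly when `K` is stabilizing (`stabilizing_iff`). Policy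
evaluation is thus a Lyapunov equation for `F`, with running cost quadratic in `ẋ`.

Data step. Since `A` is invertible, `x = A⁻¹ẋ - A⁻¹Bu`, and the rate of `xᵀPx` becomes an expression
in `ẋ` and `u` alone (`value_rate_identity`). Integrated over a window, it says that `P`, `-2 P xb`
and the improved gain solve the linear system with matrix `X(K)`. The measurement bias only adds
terms affine in `x`, which `ε = -2 P xb` absorbs up to a constant (`bias_form`). The identity holds
for every right-hand side `W` of the Lyapunov equation. With `W = 0`, full column rank makes the
homogeneous Lyapunov equation injective on symmetric matrices, hence the evaluation equation
solvable; with `W = Q + KᵀRK`, it identifies least squares with that solution.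

Convergence is Kleinman's argument. Completing the square (`evaluation_eq_riccati_add`) shows that
`P` satisfies the evaluation equation of the next gain with an extra semidefinite term.
Observability turns this into stability of the next gain (`stabilizing_of_lyapunov`), and Lyapunov
comparison into `P (i+1) ≤ P i`. A decreasing sequence of semidefinite matrices converges; its limit
solves the Riccati equation, and comparison gives uniqueness among positive definite solutions. -/

namespace DFC

/-! ### Hurwitz matrices, the Cayley transform and the Lyapunov inequality. -/

section Spectral

variable {n : ℕ}

/-- The complexification of a real matrix. -/
abbrev toComplex {k l : ℕ} (M : Matrix (Fin k) (Fin l) ℝ) : Matrix (Fin k) (Fin l) ℂ :=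
  M.map (fun r : ℝ => (r : ℂ))

theorem toComplex_mul {k l p : ℕ} (M : Matrix (Fin k) (Fin l) ℝ) (N : Matrix (Fin l) (Fin p) ℝ) :
    toComplex (M * N) = toComplex M * toComplex N :=
  Matrix.map_mul (f := Complex.ofRealHom)

theorem toComplex_add {k l : ℕ} (M N : Matrix (Fin k) (Fin l) ℝ) :
    toComplex (M + N) = toComplex M + toComplex N := by
  ext i j; simp

theorem toComplex_one : toComplex (1 : Matrix (Fin n) (Fin n) ℝ) = 1 :=
  Matrix.map_one _ (by simp) (by simp)

theorem toComplex_pow (M : Matrix (Fin n) (Fin n) ℝ) (k : ℕ) :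
    toComplex (M ^ k) = toComplex M ^ k := by
  induction k with
  | zero => simp only [pow_zero, toComplex_one]
  | succ k ih => rw [pow_succ, pow_succ, toComplex_mul, ih]

theorem mem_spectrum_iff_exists_eigenvector (M : Matrix (Fin n) (Fin n) ℂ) (z : ℂ) :
    z ∈ spectrum ℂ M ↔ ∃ v : Fin n → ℂ, v ≠ 0 ∧ M *ᵥ v = z • v := by
  rw [← Matrix.spectrum_toLin', ← Module.End.hasEigenvalue_iff_mem_spectrum]
  constructor
  · intro h
    obtain ⟨v, hv⟩ := h.exists_hasEigenvector
    exact ⟨v, hv.2, by simpa using hv.apply_eq_smul⟩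
  · rintro ⟨v, hv, h⟩
    exact Module.End.hasEigenvalue_of_hasEigenvector
      (x := v) ⟨Module.End.mem_eigenspace_iff.2 (by simpa using h), hv⟩

theorem hurwitz_iff (M : Matrix (Fin n) (Fin n) ℝ) :
    Hurwitz M ↔ ∀ (z : ℂ) (v : Fin n → ℂ), v ≠ 0 → toComplex M *ᵥ v = z • v → z.re < 0 := by
  constructor
  · intro h z v hv hz
    exact h z ((mem_spectrum_iff_exists_eigenvector _ _).2 ⟨v, hv, hz⟩)
  · intro h z hz
    obtain ⟨v, hv, hz⟩ := (mem_spectrum_iff_exists_eigenvector _ _).1 hz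
    exact h z v hv hz

section Powers

attribute [local instance] Matrix.linftyOpNormedRing Matrix.linftyOpNormedAlgebra

/-- Gelfand's formula: `‖M ^ k‖ ^ (1/k)` tends to the spectral radius, so `‖M ^ k‖` is eventually at
most `r ^ k` for some `r < 1`. -/
theorem tendsto_pow_of_spectrum_lt_one (M : Matrix (Fin n) (Fin n) ℂ)
    (h : ∀ z ∈ spectrum ℂ M, ‖z‖ < 1) : Tendsto (fun k => M ^ k) atTop (𝓝 0) := by
  rcases isEmpty_or_nonempty (Fin n) with hn | hn
  · have : ∀ k, M ^ k = 0 := fun k => Subsingleton.elim _ _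
    simp [this]
  have hr : spectralRadius ℂ M < (1 : NNReal) :=
    spectrum.spectralRadius_lt_of_forall_lt M (fun z hz => by
      rw [← NNReal.coe_lt_coe]; simpa using h z hz)
  obtain ⟨r, hr1, hr2⟩ := ENNReal.lt_iff_exists_nnreal_btwn.1 hr
  have hg := spectrum.pow_nnnorm_pow_one_div_tendsto_nhds_spectralRadius M
  have hev := hg.eventually_lt_const hr1
  have hr2' : (r : ℝ) < 1 := by exact_mod_cast hr2
  refine squeeze_zero_norm' ?_ (tendsto_pow_atTop_nhds_zero_of_lt_one r.coe_nonneg hr2')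
  filter_upwards [hev, eventually_ge_atTop 1] with k hk hk1
  have hk0 : (k : ℝ) ≠ 0 := by positivity
  have h1 := ENNReal.rpow_le_rpow hk.le (Nat.cast_nonneg (α := ℝ) k)
  rw [← ENNReal.rpow_mul, one_div_mul_cancel hk0, ENNReal.rpow_one, ENNReal.rpow_natCast] at h1
  have h2 : ‖M ^ k‖₊ ≤ r ^ k := by exact_mod_cast h1
  exact_mod_cast h2

end Powers

theorem tendsto_pow_of_toComplex {G : Matrix (Fin n) (Fin n) ℝ}
    (h : Tendsto (fun k => toComplex G ^ k) atTop (𝓝 0)) :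
    Tendsto (fun k => G ^ k) atTop (𝓝 0) := by
  refine tendsto_pi_nhds.2 fun i => tendsto_pi_nhds.2 fun j => ?_
  have h1 := tendsto_pi_nhds.1 (tendsto_pi_nhds.1 h i) j
  have h2 := (Complex.continuous_re.tendsto _).comp h1
  refine (h2.congr fun k => ?_)
  simp [← toComplex_pow]

/-- The real part of `(μ - 1) * conj (μ + 1)` is `‖μ‖² - 1`. The value `μ = -1` is excluded by the
hypothesis, because division by zero gives `0`. -/
theorem re_cayley {μ : ℂ} (h : ((μ - 1) / (μ + 1)).re < 0) : ‖μ‖ < 1 := by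
  have h0 : μ + 1 ≠ 0 := by
    intro h0; simp [h0] at h
  have hp : 0 < Complex.normSq (μ + 1) := Complex.normSq_pos.2 h0
  rw [Complex.div_re, ← add_div, div_lt_iff₀ hp] at h
  have h2 : ‖μ‖ ^ 2 < 1 := by
    rw [← Complex.normSq_eq_norm_sq, Complex.normSq_apply]
    simp at h
    nlinarith
  nlinarith [norm_nonneg μ]

theorem Hurwitz.isUnit_one_sub {F : Matrix (Fin n) (Fin n) ℝ} (hF : Hurwitz F) :
    IsUnit (1 - F).det := by
  rw [isUnit_iff_ne_zero]
  intro h0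
  obtain ⟨v, hv, h⟩ := Matrix.exists_mulVec_eq_zero_iff.2 h0
  have h1 : F *ᵥ v = v := by
    rw [sub_mulVec, one_mulVec, sub_eq_zero] at h; exact h.symm
  have := (hurwitz_iff F).1 hF 1 (fun i => (v i : ℂ)) (by
    intro h2; apply hv; ext i; simpa using congrFun h2 i) (by
    ext i
    have := congrFun h1 i
    rw [one_smul, ← this]
    simp [mulVec, dotProduct])
  norm_num at this

/-- An eigenvector `w` of the Cayley transform for `μ` yields the eigenvector `(1 - F)⁻¹ w` of `F`
for `(μ - 1)/(μ + 1)`. That number lies in the left half-plane, so `‖μ‖ < 1`. -/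
theorem Hurwitz.tendsto_cayley_pow {F : Matrix (Fin n) (Fin n) ℝ} (hF : Hurwitz F) :
    Tendsto (fun k => ((1 + F) * (1 - F)⁻¹) ^ k) atTop (𝓝 0) := by
  refine tendsto_pow_of_toComplex (tendsto_pow_of_spectrum_lt_one _ fun μ hμ => ?_)
  obtain ⟨w, hw, h⟩ := (mem_spectrum_iff_exists_eigenvector _ _).1 hμ
  set N := (1 - F)⁻¹ with hN
  have hN1 : (1 - F) * N = 1 := Matrix.mul_nonsing_inv _ hF.isUnit_one_sub
  set v := toComplex N *ᵥ w with hv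
  have hc1 : toComplex (1 + F) = 1 + toComplex F := by rw [toComplex_add, toComplex_one]
  have hc2 : toComplex (1 - F) = 1 - toComplex F := by
    rw [eq_sub_iff_add_eq, ← toComplex_add, sub_add_cancel, toComplex_one]
  have hwv : w = v - toComplex F *ᵥ v := by
    have : w = toComplex ((1 - F) * N) *ᵥ w := by rw [hN1, toComplex_one, one_mulVec]
    rw [this, toComplex_mul, ← mulVec_mulVec, ← hv, hc2, sub_mulVec, one_mulVec]
  have hv0 : v ≠ 0 := by
    intro h0; rw [h0, mulVec_zero, sub_zero] at hwv; exact hw hwv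
  have h1 : v + toComplex F *ᵥ v = μ • (v - toComplex F *ᵥ v) := by
    rw [← hwv, ← h, toComplex_mul, ← mulVec_mulVec, ← hv, hc1, add_mulVec, one_mulVec]
  have h2 : (μ + 1) • (toComplex F *ᵥ v) = (μ - 1) • v := by
    ext i
    have := congrFun h1 i
    simp only [Pi.add_apply, Pi.smul_apply, Pi.sub_apply, smul_eq_mul] at this ⊢
    linear_combination this
  have hμ1 : μ + 1 ≠ 0 := by
    intro h0
    rw [h0, zero_smul] at h2
    have h3 : μ - 1 ≠ 0 := by
      intro h4
      have : (2 : ℂ) = 0 := by linear_combination h0 - h4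
      norm_num at this
    exact hv0 ((smul_eq_zero.1 h2.symm).resolve_left h3)
  refine re_cayley ((hurwitz_iff F).1 hF _ v hv0 ?_)
  rw [div_eq_inv_mul, mul_smul, ← h2, smul_smul, inv_mul_cancel₀ hμ1, one_smul]

/-- The Cayley transform `G` turns the equation into the discrete one `P - GᵀPG ≥ 0`. The form of
`P` therefore decreases along `G ^ k v`, and it tends to `0` because `G ^ k` does; so it is
nonnegative at `k = 0`. This replaces the usual integral of matrix exponentials. -/
theorem Hurwitz.posSemidef_of_lyapunov {F P W : Matrix (Fin n) (Fin n) ℝ} (hF : Hurwitz F)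
    (hP : P.IsSymm) (hW : W.PosSemidef) (h : P * F + Fᵀ * P + W = 0) : P.PosSemidef := by
  set N := (1 - F)⁻¹ with hN
  have hN1 : (1 - F) * N = 1 := Matrix.mul_nonsing_inv _ hF.isUnit_one_sub
  have hN2 : Nᵀ * (1 - F)ᵀ = 1 := by rw [← transpose_mul, hN1, transpose_one]
  set G := (1 + F) * N with hG
  -- After congruence by `N`, this is `(1-F)ᵀP(1-F) - (1+F)ᵀP(1+F) = -2(PF + FᵀP) = 2W`.
  have hS : P - Gᵀ * P * G = Nᵀ * ((2 : ℝ) • W) * N := by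
    have hPe : P = Nᵀ * ((1 - F)ᵀ * P * (1 - F)) * N := by
      calc P = (Nᵀ * (1 - F)ᵀ) * P * ((1 - F) * N) := by rw [hN1, hN2]; simp
        _ = _ := by simp only [Matrix.mul_assoc]
    have hGe : Gᵀ * P * G = Nᵀ * ((1 + F)ᵀ * P * (1 + F)) * N := by
      rw [hG, transpose_mul]; simp only [Matrix.mul_assoc]
    have hWe : W = -(P * F + Fᵀ * P) := by rw [eq_neg_iff_add_eq_zero, add_comm, h]
    rw [hGe]
    nth_rewrite 1 [hPe]
    rw [← Matrix.sub_mul, ← Matrix.mul_sub, hWe, two_smul]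
    congr 2
    simp only [transpose_add, transpose_sub, transpose_one]
    noncomm_ring
  have hS0 : (P - Gᵀ * P * G).PosSemidef := by
    rw [hS]
    have := (hW.smul (a := (2 : ℝ)) (by norm_num)).conjTranspose_mul_mul_same N
    simpa using this
  refine PosSemidef.of_dotProduct_mulVec_nonneg 
    (by rw [IsHermitian, conjTranspose_eq_transpose_of_trivial]; exact hP) fun v => ?_
  rw [star_trivial]
  have hanti : Antitone fun k => (G ^ k *ᵥ v) ⬝ᵥ (P *ᵥ (G ^ k *ᵥ v)) := by
    refine antitone_nat_of_succ_le fun k => ?_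
    have h1 := hS0.dotProduct_mulVec_nonneg (G ^ k *ᵥ v)
    rw [star_trivial, sub_mulVec, dotProduct_sub, sub_nonneg] at h1
    refine le_trans (le_of_eq ?_) h1
    rw [pow_succ', ← mulVec_mulVec (M := G), ← mulVec_mulVec (N := G),
      ← mulVec_mulVec (M := Gᵀ), dotProduct_mulVec _ Gᵀ, vecMul_transpose]
  have hlim : Tendsto (fun k => (G ^ k *ᵥ v) ⬝ᵥ (P *ᵥ (G ^ k *ᵥ v))) atTop (𝓝 0) := by
    have hc : Continuous fun M : Matrix (Fin n) (Fin n) ℝ => (M *ᵥ v) ⬝ᵥ (P *ᵥ (M *ᵥ v)) := by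
      fun_prop
    have := (hc.tendsto 0).comp hF.tendsto_cayley_pow
    rwa [zero_mulVec, zero_dotProduct] at this
  have := hanti.le_of_tendsto hlim 0
  simpa using this

end Spectral

end DFC

namespace DFC

theorem mulVec_injective_of_rank_eq_card {ι κ : Type*} [Fintype ι] [Fintype κ]
    {M : Matrix ι κ ℝ} (h : M.rank = Fintype.card κ) : Function.Injective M.mulVec := by
  classical
  have h1 := M.mulVecLin.finrank_range_add_finrank_ker
  rw [Module.finrank_fintype_fun_eq_card, ← h, Matrix.rank] at h1
  have h2 : Module.finrank ℝ (LinearMap.ker M.mulVecLin) = 0 := by omega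
  exact LinearMap.ker_eq_bot.1 (Submodule.finrank_eq_zero.1 h2)

/-! ### Observability, Lyapunov certificates of stability, and policy iteration. -/

section Riccati

variable {n m : ℕ} {A : Matrix (Fin n) (Fin n) ℝ} {B : Matrix (Fin n) (Fin m) ℝ}
  {Q : Matrix (Fin n) (Fin n) ℝ} {R : Matrix (Fin m) (Fin m) ℝ}

theorem Observable.eq_zero {l : ℕ} {C : Matrix (Fin l) (Fin n) ℝ} (h : Observable C A)
    {v : Fin n → ℝ} (hv : ∀ k : ℕ, C *ᵥ (A ^ k *ᵥ v) = 0) : v = 0 := by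
  refine mulVec_injective_of_rank_eq_card (h.trans (Fintype.card_fin n).symm) ?_
  rw [mulVec_zero]
  ext q
  have := congrFun (hv q.1) q.2
  rwa [mulVec_mulVec] at this

theorem PosSemidef.psdSqrt_mulVec_eq_zero (hQ : Q.PosSemidef) {v : Fin n → ℝ}
    (hv : Q *ᵥ v = 0) : psdSqrt Q *ᵥ v = 0 := by
  open scoped MatrixOrder in
  have h0 : (psdSqrt Q).PosSemidef := Matrix.nonneg_iff_posSemidef.1 (CFC.sqrt_nonneg Q)
  have h1 : psdSqrt Q * psdSqrt Q = Q :=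
    CFC.sqrt_mul_sqrt_self Q (Matrix.nonneg_iff_posSemidef.2 hQ)
  rw [← h1, ← mulVec_mulVec] at hv
  have h2 : (psdSqrt Q *ᵥ v) ⬝ᵥ (psdSqrt Q *ᵥ v) = 0 := by
    have hs : (psdSqrt Q)ᵀ = psdSqrt Q := by simpa using h0.1.eq
    nth_rewrite 1 [← hs]
    rw [mulVec_transpose, ← dotProduct_mulVec, hv, dotProduct_zero]
  exact dotProduct_self_eq_zero.1 h2

/-- In finite dimension the injective map `A⁻¹` maps `V` onto itself, so `V` is `A`-invariant too.
Every `A ^ k v` then lies in the kernel of `Q`, and observability forces `v = 0`. -/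
theorem eq_bot_of_inv_invariant (hA : IsUnit A.det) (hQ : Q.PosSemidef)
    (hQA : Observable (psdSqrt Q) A) (V : Submodule ℝ (Fin n → ℝ))
    (hV : ∀ v ∈ V, A⁻¹ *ᵥ v ∈ V) (hQV : ∀ v ∈ V, Q *ᵥ v = 0) : V = ⊥ := by
  have hAV : ∀ v ∈ V, A *ᵥ v ∈ V := by
    let f : V →ₗ[ℝ] V := (A⁻¹).mulVecLin.restrict hV
    have hf : Function.Injective f := by
      intro a b hab
      have h1 : A⁻¹ *ᵥ (a : Fin n → ℝ) = A⁻¹ *ᵥ (b : Fin n → ℝ) := congrArg Subtype.val hab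
      have h2 := congrArg (A *ᵥ ·) h1
      simp only [mulVec_mulVec, Matrix.mul_nonsing_inv _ hA, one_mulVec] at h2
      exact Subtype.ext h2
    intro v hv
    obtain ⟨w, hw⟩ := LinearMap.injective_iff_surjective.1 hf ⟨v, hv⟩
    have h1 : A⁻¹ *ᵥ (w : Fin n → ℝ) = v := congrArg Subtype.val hw
    rw [← h1, mulVec_mulVec, Matrix.mul_nonsing_inv _ hA, one_mulVec]
    exact w.2
  have hAk : ∀ (k : ℕ), ∀ v ∈ V, A ^ k *ᵥ v ∈ V := by
    intro k
    induction k with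
    | zero => intro v hv; simpa using hv
    | succ k ih =>
      intro v hv
      rw [pow_succ', ← mulVec_mulVec]
      exact hAV _ (ih v hv)
  rw [Submodule.eq_bot_iff]
  intro v hv
  exact hQA.eq_zero fun k => PosSemidef.psdSqrt_mulVec_eq_zero hQ (hQV _ (hAk k v hv))

theorem transpose_mul_mul_posSemidef {k l : ℕ} {S : Matrix (Fin k) (Fin k) ℝ}
    (hS : S.PosSemidef) (M : Matrix (Fin k) (Fin l) ℝ) : (Mᵀ * S * M).PosSemidef := by
  simpa using hS.conjTranspose_mul_mul_same M

theorem isSymm_of_isHermitian {P : Matrix (Fin n) (Fin n) ℝ} (h : P.IsHermitian) : P.IsSymm := by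
  rw [IsHermitian, conjTranspose_eq_transpose_of_trivial] at h; exact h

theorem IsSymm.isHermitian_real {P : Matrix (Fin n) (Fin n) ℝ} (h : P.IsSymm) :
    P.IsHermitian := by
  rw [IsHermitian, conjTranspose_eq_transpose_of_trivial]; exact h

theorem PosSemidef.nonneg_form {P : Matrix (Fin n) (Fin n) ℝ} (h : P.PosSemidef)
    (v : Fin n → ℝ) : 0 ≤ v ⬝ᵥ (P *ᵥ v) := by
  simpa using h.dotProduct_mulVec_nonneg v

theorem PosSemidef.mulVec_eq_zero {P : Matrix (Fin n) (Fin n) ℝ} (h : P.PosSemidef)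
    {v : Fin n → ℝ} (hv : v ⬝ᵥ (P *ᵥ v) = 0) : P *ᵥ v = 0 :=
  (h.dotProduct_mulVec_zero_iff v).1 (by simpa using hv)

theorem form_transpose_mul_mul {k l : ℕ} (S : Matrix (Fin k) (Fin k) ℝ)
    (M : Matrix (Fin k) (Fin l) ℝ) (v : Fin l → ℝ) :
    v ⬝ᵥ ((Mᵀ * S * M) *ᵥ v) = (M *ᵥ v) ⬝ᵥ (S *ᵥ (M *ᵥ v)) := by
  rw [← mulVec_mulVec, ← mulVec_mulVec, dotProduct_mulVec, vecMul_transpose]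

theorem PosDef.eq_zero_of_form {k : ℕ} {S : Matrix (Fin k) (Fin k) ℝ} (h : S.PosDef)
    {v : Fin k → ℝ} (hv : v ⬝ᵥ (S *ᵥ v) ≤ 0) : v = 0 := by
  by_contra h0
  have := h.dotProduct_mulVec_pos h0
  rw [star_trivial] at this
  linarith

/-- The null vectors of the running cost `Q + Kᵀ R K` are annihilated by `Q` and by `K`. -/
theorem cost_form_nonpos (hQ : Q.PosSemidef) (hR : R.PosDef) {K : Matrix (Fin m) (Fin n) ℝ}
    {v : Fin n → ℝ} (hv : v ⬝ᵥ ((Q + Kᵀ * R * K) *ᵥ v) ≤ 0) : Q *ᵥ v = 0 ∧ K *ᵥ v = 0 := by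
  rw [add_mulVec, dotProduct_add, form_transpose_mul_mul] at hv
  have h1 := PosSemidef.nonneg_form hQ v
  have h2 := PosSemidef.nonneg_form hR.posSemidef (K *ᵥ v)
  exact ⟨PosSemidef.mulVec_eq_zero hQ (by linarith), PosDef.eq_zero_of_form hR (by linarith)⟩

theorem closedLoop_mulVec {K : Matrix (Fin m) (Fin n) ℝ} {v : Fin n → ℝ} (hv : K *ᵥ v = 0) :
    (A⁻¹ * (1 + B * K)) *ᵥ v = A⁻¹ *ᵥ v := by
  rw [← mulVec_mulVec, add_mulVec, one_mulVec, ← mulVec_mulVec, hv, mulVec_zero, add_zero]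

theorem form_lyapunov {P : Matrix (Fin n) (Fin n) ℝ} (hP : P.IsSymm)
    (F : Matrix (Fin n) (Fin n) ℝ) (v : Fin n → ℝ) :
    v ⬝ᵥ ((P * F + Fᵀ * P) *ᵥ v) = 2 * ((P *ᵥ v) ⬝ᵥ (F *ᵥ v)) := by
  have h1 : v ⬝ᵥ ((P * F) *ᵥ v) = (P *ᵥ v) ⬝ᵥ (F *ᵥ v) := by
    rw [← mulVec_mulVec, dotProduct_mulVec, ← mulVec_transpose, hP.eq]
  have h2 : v ⬝ᵥ ((Fᵀ * P) *ᵥ v) = (P *ᵥ v) ⬝ᵥ (F *ᵥ v) := by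
    rw [← mulVec_mulVec, dotProduct_mulVec, vecMul_transpose, dotProduct_comm]
  rw [add_mulVec, dotProduct_add, h1, h2]; ring

/-- The kernel of `P` is an `A⁻¹`-invariant subspace of the kernel of `Q`, hence trivial. For `v` in
it, the form of the equation gives `Qv = 0` and `Kv = 0`; the equation applied to `v` then reduces
to `P A⁻¹ v = 0`. -/
theorem SolvesEvaluation.posDef (hA : IsUnit A.det) (hQ : Q.PosSemidef) (hR : R.PosDef)
    (hQA : Observable (psdSqrt Q) A) {K : Matrix (Fin m) (Fin n) ℝ}
    {P : Matrix (Fin n) (Fin n) ℝ} (h : SolvesEvaluation A B Q R K P) (hP : P.PosSemidef) :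
    P.PosDef := by
  have hPs := isSymm_of_isHermitian hP.1
  have hker : ∀ v, P *ᵥ v = 0 → (Q *ᵥ v = 0 ∧ K *ᵥ v = 0) := by
    intro v hv
    refine cost_form_nonpos hQ hR (le_of_eq ?_)
    have h1 := congrArg (fun M => v ⬝ᵥ (M *ᵥ v)) h
    rw [add_assoc, add_mulVec, dotProduct_add, form_lyapunov hPs, hv] at h1
    simpa using h1
  have hbot := eq_bot_of_inv_invariant hA hQ hQA (LinearMap.ker P.mulVecLin) (by
      intro v hv
      have hv0 : P *ᵥ v = 0 := hv
      obtain ⟨h1, h2⟩ := hker v hv0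
      have h3 := congrArg (· *ᵥ v) h
      simp only [add_mulVec, ← mulVec_mulVec (M := P), ← mulVec_mulVec (N := P), hv0, h1,
        closedLoop_mulVec h2, ← mulVec_mulVec (N := K), h2, mulVec_zero, add_zero,
        zero_mulVec] at h3
      exact h3)
    (fun v hv => (hker v hv).1)
  refine PosDef.of_dotProduct_mulVec_pos hP.1 fun v hv => ?_
  rw [star_trivial]
  refine lt_of_le_of_ne (PosSemidef.nonneg_form hP v) fun h0 => hv ?_
  have : v ∈ LinearMap.ker P.mulVecLin := PosSemidef.mulVec_eq_zero hP h0.symm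
  rwa [hbot, Submodule.mem_bot] at this

/-- Real form of the eigenvalue test: `a` and `b` are the real and imaginary parts of an eigenvector
for `α + βi`. -/
theorem hurwitz_of_real {M : Matrix (Fin n) (Fin n) ℝ}
    (h : ∀ (α β : ℝ) (a b : Fin n → ℝ), (a ≠ 0 ∨ b ≠ 0) → M *ᵥ a = α • a - β • b →
      M *ᵥ b = β • a + α • b → α < 0) : Hurwitz M := by
  rw [hurwitz_iff]
  intro z v hv hz
  have hre : ∀ i, (toComplex M *ᵥ v) i
      = ((M *ᵥ fun j => (v j).re) i : ℝ) + ((M *ᵥ fun j => (v j).im) i : ℝ) * Complex.I := by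
    intro i
    simp only [mulVec, dotProduct, Matrix.map_apply]
    push_cast
    rw [Finset.sum_mul, ← Finset.sum_add_distrib]
    refine Finset.sum_congr rfl fun j _ => ?_
    nth_rewrite 1 [← Complex.re_add_im (v j)]
    ring
  refine h z.re z.im (fun j => (v j).re) (fun j => (v j).im) ?_ ?_ ?_
  · by_contra! h0
    apply hv
    ext i
    exact Complex.ext (congrFun h0.1 i) (congrFun h0.2 i)
  · ext i
    have := congrArg Complex.re ((hre i).symm.trans (congrFun hz i))
    simpa using this
  · ext i
    have := congrArg Complex.im ((hre i).symm.trans (congrFun hz i))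
    simp at this
    simp [this]; ring

theorem Hurwitz.isUnit_det {M : Matrix (Fin n) (Fin n) ℝ} (h : Hurwitz M) : IsUnit M.det := by
  rw [isUnit_iff_ne_zero]
  intro h0
  obtain ⟨v, hv, hv0⟩ := Matrix.exists_mulVec_eq_zero_iff.2 h0
  have := (hurwitz_iff M).1 h 0 (fun i => (v i : ℂ)) (by
    intro h2; apply hv; ext i; simpa using congrFun h2 i) (by
    ext i
    have := congrArg (fun r : ℝ => (r : ℂ)) (congrFun hv0 i)
    simpa [mulVec, dotProduct] using this)
  norm_num at this

theorem Hurwitz.inv {M : Matrix (Fin n) (Fin n) ℝ} (h : Hurwitz M) : Hurwitz M⁻¹ := by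
  rw [hurwitz_iff]
  intro z v hv hz
  have h1 : v = z • (toComplex M *ᵥ v) := by
    rw [← mulVec_smul, ← hz, mulVec_mulVec, ← toComplex_mul, Matrix.mul_nonsing_inv _ h.isUnit_det,
      toComplex_one, one_mulVec]
  have hz0 : z ≠ 0 := by
    rintro rfl
    exact hv (by simpa using h1)
  have h2 := (hurwitz_iff M).1 h z⁻¹ v hv (by
    nth_rewrite 2 [h1]
    rw [smul_smul, inv_mul_cancel₀ hz0, one_smul])
  rw [Complex.inv_re] at h2
  have := Complex.normSq_pos.2 hz0
  by_contra! h3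
  exact absurd h2 (not_lt.2 (by positivity))

/-- The two matrices are inverse to each other, and `z⁻¹` has a real part of the same sign as `z`.
Invertibility of `1 + BK` is automatic from right to left, since a Hurwitz matrix has nonzero
determinant. -/
theorem stabilizing_iff (hA : IsUnit A.det) {K : Matrix (Fin m) (Fin n) ℝ} :
    Stabilizing A B K ↔ Hurwitz (A⁻¹ * (1 + B * K)) := by
  constructor
  · rintro ⟨h1, h2⟩
    have := h2.inv
    rwa [Matrix.mul_inv_rev, Matrix.nonsing_inv_nonsing_inv _ h1] at this
  · intro h
    have h1 : IsUnit (1 + B * K).det := by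
      have := h.isUnit_det
      rw [det_mul] at this
      exact isUnit_of_mul_isUnit_right this
    refine ⟨h1, ?_⟩
    have := h.inv
    rwa [Matrix.mul_inv_rev, Matrix.nonsing_inv_nonsing_inv _ hA] at this

/-- An invariance argument in the style of LaSalle: along an eigenvector with nonnegative real part,
every term of the equation is nonnegative, so the cost vanishes there. Hence `F` acts as `A⁻¹` on
the span of its real and imaginary parts, and observability makes that span trivial. -/
theorem stabilizing_of_lyapunov (hA : IsUnit A.det) (hQ : Q.PosSemidef) (hR : R.PosDef)
    (hQA : Observable (psdSqrt Q) A) {K : Matrix (Fin m) (Fin n) ℝ}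
    {P S : Matrix (Fin n) (Fin n) ℝ} (hP : P.PosDef) (hS : S.PosSemidef)
    (h : P * (A⁻¹ * (1 + B * K)) + (A⁻¹ * (1 + B * K))ᵀ * P + Q + Kᵀ * R * K + S = 0) :
    Stabilizing A B K := by
  rw [stabilizing_iff hA]
  refine hurwitz_of_real fun α β a b hab ha hb => ?_
  by_contra! hα
  set F := A⁻¹ * (1 + B * K) with hF
  have hPs := isSymm_of_isHermitian hP.1
  have hform : ∀ v, 2 * ((P *ᵥ v) ⬝ᵥ (F *ᵥ v)) + v ⬝ᵥ ((Q + Kᵀ * R * K) *ᵥ v)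
      + v ⬝ᵥ (S *ᵥ v) = 0 := by
    intro v
    have h1 := congrArg (fun M => v ⬝ᵥ (M *ᵥ v)) h
    rw [add_assoc (P * F + Fᵀ * P), add_mulVec, dotProduct_add, add_mulVec, dotProduct_add,
      form_lyapunov hPs] at h1
    simpa using h1
  have hW : (Q + Kᵀ * R * K).PosSemidef := hQ.add (transpose_mul_mul_posSemidef hR.posSemidef K)
  -- By symmetry of `P` the cross terms in `β` cancel when the forms at `a` and `b` are added.
  have hsym : (P *ᵥ a) ⬝ᵥ b = (P *ᵥ b) ⬝ᵥ a := by
    rw [dotProduct_comm (P *ᵥ b), dotProduct_mulVec, ← mulVec_transpose, hPs.eq]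
  have ea := hform a
  have eb := hform b
  rw [ha, dotProduct_sub, dotProduct_smul, dotProduct_smul] at ea
  rw [hb, dotProduct_add, dotProduct_smul, dotProduct_smul] at eb
  simp only [smul_eq_mul] at ea eb
  rw [hsym] at ea
  have pa := PosSemidef.nonneg_form hP.posSemidef a
  have pb := PosSemidef.nonneg_form hP.posSemidef b
  rw [dotProduct_comm] at pa pb
  have wa := PosSemidef.nonneg_form hW a
  have wb := PosSemidef.nonneg_form hW b
  have sa := PosSemidef.nonneg_form hS a
  have sb := PosSemidef.nonneg_form hS b
  have qa := mul_nonneg hα pa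
  have qb := mul_nonneg hα pb
  obtain ⟨ha1, ha2⟩ := cost_form_nonpos hQ hR (K := K) (v := a) (by linarith)
  obtain ⟨hb1, hb2⟩ := cost_form_nonpos hQ hR (K := K) (v := b) (by linarith)
  rw [hF, closedLoop_mulVec ha2] at ha
  rw [hF, closedLoop_mulVec hb2] at hb
  have hmem : ∀ v ∈ Submodule.span ℝ {a, b}, Q *ᵥ v = 0 ∧ A⁻¹ *ᵥ v ∈ Submodule.span ℝ {a, b} := by
    intro v hv
    obtain ⟨c, d, rfl⟩ := Submodule.mem_span_pair.1 hv
    have ma : a ∈ Submodule.span ℝ {a, b} := Submodule.subset_span (by simp)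
    have mb : b ∈ Submodule.span ℝ {a, b} := Submodule.subset_span (by simp)
    refine ⟨by simp [mulVec_add, mulVec_smul, ha1, hb1], ?_⟩
    rw [mulVec_add, mulVec_smul, mulVec_smul, ha, hb]
    exact add_mem (Submodule.smul_mem _ _ (sub_mem (Submodule.smul_mem _ _ ma)
      (Submodule.smul_mem _ _ mb))) (Submodule.smul_mem _ _ (add_mem (Submodule.smul_mem _ _ ma)
      (Submodule.smul_mem _ _ mb)))
  have hbot := eq_bot_of_inv_invariant hA hQ hQA _ (fun v hv => (hmem v hv).2)
    (fun v hv => (hmem v hv).1)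
  rw [Submodule.span_eq_bot] at hbot
  exact hab.elim (fun h => h (hbot a (by simp))) (fun h => h (hbot b (by simp)))

/-- Completion of the square: the evaluation residual of a gain `K` exceeds the Riccati residual
by the quadratic distance of `K` from the improved gain. -/
theorem evaluation_eq_riccati_add (hR : R.PosDef) {P : Matrix (Fin n) (Fin n) ℝ} (hP : P.IsSymm)
    (K : Matrix (Fin m) (Fin n) ℝ) :
    P * (A⁻¹ * (1 + B * K)) + (A⁻¹ * (1 + B * K))ᵀ * P + Q + Kᵀ * R * K =
      (P * A⁻¹ + A⁻¹ᵀ * P - P * A⁻¹ * B * R⁻¹ * Bᵀ * A⁻¹ᵀ * P + Q) +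
        (K - gainOf A B R P)ᵀ * R * (K - gainOf A B R P) := by
  have hRs := isSymm_of_isHermitian hR.1
  have hRu : IsUnit R.det := (Matrix.isUnit_iff_isUnit_det _).1 hR.isUnit
  set L := gainOf A B R P with hL
  have h1 : R * L = -(Bᵀ * A⁻¹ᵀ * P) := by
    rw [hL, gainOf, Matrix.mul_neg, Matrix.mul_assoc R⁻¹, Matrix.mul_assoc R⁻¹,
      Matrix.mul_nonsing_inv_cancel_left _ _ hRu]
  have h2 : Lᵀ * R = -(P * A⁻¹ * B) := by
    have := congrArg transpose h1
    simpa [hRs.eq, hP.eq, Matrix.mul_assoc] using this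
  have h3 : P * A⁻¹ * B * R⁻¹ * Bᵀ * A⁻¹ᵀ * P = Lᵀ * R * L := by
    rw [h2, hL, gainOf]
    simp only [Matrix.mul_assoc, Matrix.neg_mul, Matrix.mul_neg, neg_neg]
  rw [h3]
  have h4 : P * (A⁻¹ * (1 + B * K)) = P * A⁻¹ - Lᵀ * R * K := by
    rw [h2]
    simp only [Matrix.mul_add, Matrix.mul_one, Matrix.mul_assoc, Matrix.neg_mul, sub_neg_eq_add]
  have h5 : (A⁻¹ * (1 + B * K))ᵀ * P = A⁻¹ᵀ * P - Kᵀ * R * L := by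
    rw [Matrix.mul_assoc Kᵀ, h1]
    simp only [transpose_mul, transpose_add, transpose_one, Matrix.add_mul, Matrix.one_mul,
      Matrix.mul_assoc, Matrix.mul_neg, sub_neg_eq_add]
  rw [h4, h5]
  simp only [transpose_sub, Matrix.sub_mul, Matrix.mul_sub]
  abel

theorem solvesARE_iff (hR : R.PosDef) {P : Matrix (Fin n) (Fin n) ℝ} (hP : P.IsSymm) :
    SolvesARE A B Q R P ↔ SolvesEvaluation A B Q R (gainOf A B R P) P := by
  rw [SolvesARE, SolvesEvaluation, evaluation_eq_riccati_add hR hP]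
  simp

/-- Policy improvement: the value matrix of `K` dominates the cost of the next gain. -/
theorem SolvesEvaluation.improve (hR : R.PosDef) {P : Matrix (Fin n) (Fin n) ℝ} (hP : P.IsSymm)
    {K : Matrix (Fin m) (Fin n) ℝ} (h : SolvesEvaluation A B Q R K P) :
    P * (A⁻¹ * (1 + B * gainOf A B R P)) + (A⁻¹ * (1 + B * gainOf A B R P))ᵀ * P + Q +
      (gainOf A B R P)ᵀ * R * gainOf A B R P +
        (K - gainOf A B R P)ᵀ * R * (K - gainOf A B R P) = 0 := by
  rw [SolvesEvaluation, evaluation_eq_riccati_add hR hP] at h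
  rw [evaluation_eq_riccati_add hR hP (gainOf A B R P)]
  simpa using h

/-- Subtracting the two equations leaves a Lyapunov equation for `P₁ - P₂` with right-hand side `S`.
-/
theorem sub_posSemidef_of_evaluation (hA : IsUnit A.det) {K : Matrix (Fin m) (Fin n) ℝ}
    (hK : Stabilizing A B K) {P₁ P₂ S : Matrix (Fin n) (Fin n) ℝ} (h₁ : P₁.IsSymm)
    (h₂ : P₂.IsSymm) (hS : S.PosSemidef)
    (h : P₁ * (A⁻¹ * (1 + B * K)) + (A⁻¹ * (1 + B * K))ᵀ * P₁ + Q + Kᵀ * R * K + S =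
      P₂ * (A⁻¹ * (1 + B * K)) + (A⁻¹ * (1 + B * K))ᵀ * P₂ + Q + Kᵀ * R * K) :
    (P₁ - P₂).PosSemidef := by
  refine ((stabilizing_iff hA).1 hK).posSemidef_of_lyapunov (h₁.sub h₂) hS ?_
  rw [Matrix.sub_mul, Matrix.mul_sub, ← sub_eq_zero.2 h]
  abel

theorem posSemidef_antisymm {P₁ P₂ : Matrix (Fin n) (Fin n) ℝ} (h₁ : (P₁ - P₂).PosSemidef)
    (h₂ : (P₂ - P₁).PosSemidef) : P₁ = P₂ := by
  rw [← sub_eq_zero]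
  refine Matrix.ext_of_mulVec_single fun i => ?_
  rw [zero_mulVec]
  refine PosSemidef.mulVec_eq_zero h₁ (le_antisymm ?_ (PosSemidef.nonneg_form h₁ _))
  have := PosSemidef.nonneg_form h₂ (Pi.single i 1)
  rw [← neg_sub, neg_mulVec, dotProduct_neg] at this
  linarith

theorem SolvesARE.stabilizing (hA : IsUnit A.det) (hQ : Q.PosSemidef) (hR : R.PosDef)
    (hQA : Observable (psdSqrt Q) A) {P : Matrix (Fin n) (Fin n) ℝ} (hP : P.PosDef)
    (h : SolvesARE A B Q R P) : Stabilizing A B (gainOf A B R P) := by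
  refine stabilizing_of_lyapunov hA hQ hR hQA hP PosSemidef.zero ?_
  rw [add_zero]
  exact (solvesARE_iff hR (isSymm_of_isHermitian hP.1)).1 h

/-- Both solutions are tested against the gain of `P₁`, which is stabilizing. There `P₁` has zero
evaluation residual, while `P₂` leaves the square of the difference of the two gains. -/
theorem SolvesARE.sub_posSemidef (hA : IsUnit A.det) (hQ : Q.PosSemidef) (hR : R.PosDef)
    (hQA : Observable (psdSqrt Q) A) {P₁ P₂ : Matrix (Fin n) (Fin n) ℝ} (hP₁ : P₁.PosDef)
    (hP₂ : P₂.PosDef) (h₁ : SolvesARE A B Q R P₁) (h₂ : SolvesARE A B Q R P₂) :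
    (P₁ - P₂).PosSemidef := by
  have s₁ := isSymm_of_isHermitian hP₁.1
  have s₂ := isSymm_of_isHermitian hP₂.1
  refine sub_posSemidef_of_evaluation (Q := Q) (R := R) hA (h₁.stabilizing hA hQ hR hQA hP₁)
    s₁ s₂ (transpose_mul_mul_posSemidef hR.posSemidef (gainOf A B R P₁ - gainOf A B R P₂)) ?_
  rw [evaluation_eq_riccati_add hR s₂, show _ = _ from h₂, (solvesARE_iff hR s₁).1 h₁]

theorem SolvesARE.unique (hA : IsUnit A.det) (hQ : Q.PosSemidef) (hR : R.PosDef)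
    (hQA : Observable (psdSqrt Q) A) {P₁ P₂ : Matrix (Fin n) (Fin n) ℝ} (hP₁ : P₁.PosDef)
    (hP₂ : P₂.PosDef) (h₁ : SolvesARE A B Q R P₁) (h₂ : SolvesARE A B Q R P₂) : P₁ = P₂ :=
  posSemidef_antisymm (h₁.sub_posSemidef hA hQ hR hQA hP₁ hP₂ h₂)
    (h₂.sub_posSemidef hA hQ hR hQA hP₂ hP₁ h₁)

theorem SolvesEvaluation.posDef_of_stabilizing (hA : IsUnit A.det) (hQ : Q.PosSemidef)
    (hR : R.PosDef) (hQA : Observable (psdSqrt Q) A) {K : Matrix (Fin m) (Fin n) ℝ}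
    (hK : Stabilizing A B K) {P : Matrix (Fin n) (Fin n) ℝ} (hP : P.IsSymm)
    (h : SolvesEvaluation A B Q R K P) : P.PosDef := by
  refine h.posDef hA hQ hR hQA (((stabilizing_iff hA).1 hK).posSemidef_of_lyapunov hP
    (hQ.add (transpose_mul_mul_posSemidef hR.posSemidef K)) ?_)
  rw [← add_assoc]
  exact h

/-- Polarization: convergence of all quadratic forms implies convergence of all entries. -/
theorem form_single_add_single {P : Matrix (Fin n) (Fin n) ℝ} (hP : P.IsSymm) (a b : Fin n) :
    P a b = ((Pi.single a 1 + Pi.single b 1) ⬝ᵥ (P *ᵥ (Pi.single a 1 + Pi.single b 1))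
      - Pi.single a 1 ⬝ᵥ (P *ᵥ Pi.single a 1) - Pi.single b 1 ⬝ᵥ (P *ᵥ Pi.single b 1)) / 2 := by
  have h : P b a = P a b := hP.apply a b
  simp only [mulVec_add, add_dotProduct, dotProduct_add, mulVec_single_one, single_one_dotProduct,
    col_apply, h]
  ring

/-- A sequence of positive semidefinite matrices that decreases in the Loewner order converges. -/
theorem exists_tendsto_of_decreasing {P : ℕ → Matrix (Fin n) (Fin n) ℝ}
    (hP : ∀ i, (P i).PosSemidef) (hd : ∀ i, (P i - P (i + 1)).PosSemidef) :
    ∃ L : Matrix (Fin n) (Fin n) ℝ, L.PosSemidef ∧ Tendsto P atTop (𝓝 L) := by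
  have hform : ∀ v : Fin n → ℝ, ∃ c, Tendsto (fun i => v ⬝ᵥ (P i *ᵥ v)) atTop (𝓝 c) := by
    intro v
    refine ⟨_, tendsto_atTop_ciInf (antitone_nat_of_succ_le fun i => ?_) ⟨0, ?_⟩⟩
    · have := PosSemidef.nonneg_form (hd i) v
      rw [sub_mulVec, dotProduct_sub] at this
      linarith
    · rintro _ ⟨i, rfl⟩
      exact PosSemidef.nonneg_form (hP i) v
  choose c hc using hform
  have hs := fun i => isSymm_of_isHermitian (hP i).1
  have hL : ∃ L : Matrix (Fin n) (Fin n) ℝ, Tendsto P atTop (𝓝 L) := by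
    refine ⟨Matrix.of fun a b => (c (Pi.single a 1 + Pi.single b 1) - c (Pi.single a 1)
      - c (Pi.single b 1)) / 2, tendsto_pi_nhds.2 fun a => tendsto_pi_nhds.2 fun b => ?_⟩
    refine (((hc _).sub (hc _)).sub (hc _)).div_const 2 |>.congr fun i => ?_
    exact (form_single_add_single (hs i) a b).symm
  obtain ⟨L, hL⟩ := hL
  refine ⟨L, PosSemidef.of_dotProduct_mulVec_nonneg (IsSymm.isHermitian_real ?_) fun v => ?_, hL⟩
  · have hT : Tendsto (fun i => (P i)ᵀ) atTop (𝓝 Lᵀ) :=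
      ((continuous_id.matrix_transpose).tendsto L).comp hL
    exact tendsto_nhds_unique (hT.congr fun i => (hs i).eq) hL
  · rw [star_trivial]
    have hcont : Continuous fun M : Matrix (Fin n) (Fin n) ℝ => v ⬝ᵥ (M *ᵥ v) := by fun_prop
    exact ge_of_tendsto' ((hcont.tendsto L).comp hL) fun i => PosSemidef.nonneg_form (hP i) v

/-- Convergence of model-based policy iteration. -/
theorem policyIteration_tendsto (hA : IsUnit A.det) (hQ : Q.PosSemidef) (hR : R.PosDef)
    (hQA : Observable (psdSqrt Q) A) {P : ℕ → Matrix (Fin n) (Fin n) ℝ}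
    {K : ℕ → Matrix (Fin m) (Fin n) ℝ} (hK0 : Stabilizing A B (K 0)) (hP : ∀ i, (P i).IsSymm)
    (heval : ∀ i, SolvesEvaluation A B Q R (K i) (P i))
    (hgain : ∀ i, K (i + 1) = gainOf A B R (P i)) :
    (∀ i, Stabilizing A B (K i)) ∧ ∃ L : Matrix (Fin n) (Fin n) ℝ,
      (L.PosDef ∧ SolvesARE A B Q R L) ∧
      (∀ P' : Matrix (Fin n) (Fin n) ℝ, P'.PosDef → SolvesARE A B Q R P' → P' = L) ∧
      Tendsto P atTop (𝓝 L) ∧ Tendsto K atTop (𝓝 (gainOf A B R L)) := by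
  have himp := fun i => (heval i).improve hR (hP i)
  simp only [← hgain] at himp
  have hS : ∀ i, ((K i - K (i + 1))ᵀ * R * (K i - K (i + 1))).PosSemidef := fun i =>
    transpose_mul_mul_posSemidef hR.posSemidef _
  have hstab : ∀ i, Stabilizing A B (K i) := by
    intro i
    induction i with
    | zero => exact hK0
    | succ i ih =>
      exact stabilizing_of_lyapunov hA hQ hR hQA
        ((heval i).posDef_of_stabilizing hA hQ hR hQA ih (hP i)) (hS i) (himp i)
  have hpos := fun i => (heval i).posDef_of_stabilizing hA hQ hR hQA (hstab i) (hP i)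
  obtain ⟨L, hL0, hL⟩ := exists_tendsto_of_decreasing (fun i => (hpos i).posSemidef) fun i =>
    sub_posSemidef_of_evaluation (Q := Q) (R := R) hA (hstab (i + 1)) (hP i) (hP (i + 1)) (hS i)
      ((himp i).trans (heval (i + 1)).symm)
  have hLs := isSymm_of_isHermitian hL0.1
  have hKL : Tendsto K atTop (𝓝 (gainOf A B R L)) := by
    -- Each gain after the first is a continuous function of the preceding value matrix.
    rw [← tendsto_add_atTop_iff_nat 1]
    have hc : Continuous fun M : Matrix (Fin n) (Fin n) ℝ => gainOf A B R M := by
      unfold gainOf; fun_prop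
    refine ((hc.tendsto L).comp hL).congr fun i => (hgain i).symm
  have hevL : SolvesEvaluation A B Q R (gainOf A B R L) L := by
    have hc : Continuous fun M : Matrix (Fin n) (Fin n) ℝ × Matrix (Fin m) (Fin n) ℝ =>
        M.1 * (A⁻¹ * (1 + B * M.2)) + (A⁻¹ * (1 + B * M.2))ᵀ * M.1 + Q + M.2ᵀ * R * M.2 := by
      fun_prop
    exact tendsto_nhds_unique ((hc.tendsto (L, gainOf A B R L)).comp (hL.prodMk_nhds hKL))
      (tendsto_const_nhds.congr fun i => (heval i).symm)
  -- The limit is so far only semidefinite; definiteness is regained from the limiting evaluation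
  -- equation through observability.
  have hLpos := hevL.posDef hA hQ hR hQA hL0
  have hARE := (solvesARE_iff hR hLs).2 hevL
  exact ⟨hstab, L, ⟨hLpos, hARE⟩, fun P' h1 h2 => h2.unique hA hQ hR hQA h1 hLpos hARE, hL, hKL⟩

end Riccati

end DFC

namespace DFC

/-! ### Absolute continuity and differentiation of quadratic forms along a trajectory. -/

section AbsolutelyContinuous

variable {a b : ℝ}

theorem absolutelyContinuousOnInterval_const (c : ℝ) :
    AbsolutelyContinuousOnInterval (fun _ => c) a b :=
  (LipschitzWith.const c).lipschitzOnWith.absolutelyContinuousOnInterval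

theorem absolutelyContinuousOnInterval_sum {ι : Type*} (s : Finset ι) {f : ι → ℝ → ℝ}
    (hf : ∀ i ∈ s, AbsolutelyContinuousOnInterval (f i) a b) :
    AbsolutelyContinuousOnInterval (fun t => ∑ i ∈ s, f i t) a b := by
  classical
  induction s using Finset.induction_on with
  | empty => simpa using absolutelyContinuousOnInterval_const 0
  | insert i s hi ih =>
    simp only [Finset.sum_insert hi]
    exact (hf i (by simp)).fun_add (ih fun j hj => hf j (by simp [hj]))

theorem absolutelyContinuousOnInterval_apply {n : ℕ} {x : ℝ → Fin n → ℝ}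
    (hx : AbsolutelyContinuousOnInterval x a b) (i : Fin n) :
    AbsolutelyContinuousOnInterval (fun t => x t i) a b :=
  squeeze_zero (fun _ => Finset.sum_nonneg fun _ _ => dist_nonneg)
    (fun _ => Finset.sum_le_sum fun _ _ => dist_le_pi_dist _ _ i) hx

theorem absolutelyContinuousOnInterval_form {n : ℕ} {x : ℝ → Fin n → ℝ}
    (hx : AbsolutelyContinuousOnInterval x a b) (P : Matrix (Fin n) (Fin n) ℝ) :
    AbsolutelyContinuousOnInterval (fun t => x t ⬝ᵥ (P *ᵥ x t)) a b := by
  simp only [dotProduct, mulVec]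
  exact absolutelyContinuousOnInterval_sum _ fun i _ =>
    (absolutelyContinuousOnInterval_apply hx i).fun_mul (absolutelyContinuousOnInterval_sum _
      fun k _ => (absolutelyContinuousOnInterval_apply hx k).const_mul (P i k))

end AbsolutelyContinuous

theorem hasDerivAt_form {n : ℕ} {x : ℝ → Fin n → ℝ} {y : Fin n → ℝ} {t : ℝ}
    (hx : HasDerivAt x y t) {P : Matrix (Fin n) (Fin n) ℝ} (hP : P.IsSymm) :
    HasDerivAt (fun s => x s ⬝ᵥ (P *ᵥ x s)) (2 * (y ⬝ᵥ (P *ᵥ x t))) t := by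
  have hc : ∀ i, HasDerivAt (fun s => x s i) (y i) t := hasDerivAt_pi.1 hx
  have h1 : HasDerivAt (fun s => x s ⬝ᵥ (P *ᵥ x s)) (y ⬝ᵥ (P *ᵥ x t) + x t ⬝ᵥ (P *ᵥ y)) t := by
    simp only [dotProduct, mulVec]
    rw [← Finset.sum_add_distrib]
    exact HasDerivAt.fun_sum fun i _ => (hc i).mul
      (HasDerivAt.fun_sum fun k _ => (hc k).const_mul (P i k))
  have h2 : x t ⬝ᵥ (P *ᵥ y) = y ⬝ᵥ (P *ᵥ x t) := by
    rw [dotProduct_mulVec, ← mulVec_transpose, hP.eq, dotProduct_comm]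
  rw [h2] at h1
  convert h1 using 1
  ring

/-! ### Energy balance along a trajectory. -/

section Trajectory

variable {n m : ℕ} {A : Matrix (Fin n) (Fin n) ℝ} {B : Matrix (Fin n) (Fin m) ℝ}
  {Q : Matrix (Fin n) (Fin n) ℝ} {R : Matrix (Fin m) (Fin m) ℝ}
  {τ : ℝ} {x : ℝ → Fin n → ℝ} {u : ℝ → Fin m → ℝ}

theorem IsTrajectory.memLp_input (hx : IsTrajectory A B τ x u) (c : Fin m) :
    MemLp (fun t => u t c) 2 (volume.restrict (Set.Icc 0 τ)) :=
  memLp_pi_iff.1 hx.input_memLp c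

theorem IsTrajectory.memLp_state (hx : IsTrajectory A B τ x u) (i : Fin n) :
    MemLp (fun t => x t i) 2 (volume.restrict (Set.Icc 0 τ)) := by
  rcases le_or_gt 0 τ with hτ | hτ
  · have hc := (absolutelyContinuousOnInterval_apply hx.absCont i).continuousOn
    rw [Set.uIcc_of_le hτ] at hc
    obtain ⟨C, hC⟩ := isCompact_Icc.exists_bound_of_continuousOn hc
    refine MemLp.of_bound (hc.aestronglyMeasurable measurableSet_Icc) C ?_
    exact (ae_restrict_iff' measurableSet_Icc).2 (ae_of_all _ hC)
  · simp [Set.Icc_eq_empty (not_le.2 hτ)]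

theorem IsTrajectory.memLp_deriv (hx : IsTrajectory A B τ x u) (i : Fin n) :
    MemLp (fun t => deriv x t i) 2 (volume.restrict (Set.Icc 0 τ)) := by
  have h1 : MemLp (fun t => (∑ k, A i k * x t k) + ∑ k, B i k * u t k) 2
      (volume.restrict (Set.Icc 0 τ)) :=
    (memLp_finsetSum _ fun k _ => (hx.memLp_state k).const_mul (A i k)).add
      (memLp_finsetSum _ fun k _ => (hx.memLp_input k).const_mul (B i k))
  refine h1.ae_eq ?_
  filter_upwards [hx.hasDerivAt] with t ht
  rw [ht.deriv]
  rfl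

/-- The rate of change of `ξᵀ P ξ` along `y = A ξ + B v`, expressed through `y` and `v` only. -/
theorem value_rate_identity (hA : IsUnit A.det) (hR : R.PosDef) {P W : Matrix (Fin n) (Fin n) ℝ}
    (hP : P.IsSymm) {K : Matrix (Fin m) (Fin n) ℝ}
    (h : P * (A⁻¹ * (1 + B * K)) + (A⁻¹ * (1 + B * K))ᵀ * P + W = 0)
    {ξ y : Fin n → ℝ} {v : Fin m → ℝ} (hy : y = A *ᵥ ξ + B *ᵥ v) :
    2 * (y ⬝ᵥ (P *ᵥ ξ)) = 2 * (y ⬝ᵥ ((Kᵀ * R * gainOf A B R P) *ᵥ y)) +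
      2 * (v ⬝ᵥ ((R * gainOf A B R P) *ᵥ y)) - y ⬝ᵥ (W *ᵥ y) := by
  have hRu : IsUnit R.det := (Matrix.isUnit_iff_isUnit_det _).1 hR.isUnit
  have h1 : R * gainOf A B R P = -((A⁻¹ * B)ᵀ * P) := by
    rw [gainOf, Matrix.mul_neg, Matrix.mul_assoc R⁻¹, Matrix.mul_assoc R⁻¹,
      Matrix.mul_nonsing_inv_cancel_left _ _ hRu, transpose_mul]
  -- Solving for the state removes `ξ` from the right-hand side, so the unmeasured unbiased state
  -- drops out of the integrals.
  have hξ : ξ = A⁻¹ *ᵥ y - (A⁻¹ * B) *ᵥ v := by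
    rw [hy, mulVec_add, mulVec_mulVec, Matrix.nonsing_inv_mul _ hA, one_mulVec, mulVec_mulVec,
      add_sub_cancel_right]
  have hW := congrArg (fun M => y ⬝ᵥ (M *ᵥ y)) h
  rw [add_mulVec, dotProduct_add, form_lyapunov hP, zero_mulVec, dotProduct_zero] at hW
  have hF : (A⁻¹ * (1 + B * K)) *ᵥ y = A⁻¹ *ᵥ y + (A⁻¹ * B) *ᵥ (K *ᵥ y) := by
    rw [Matrix.mul_add, Matrix.mul_one, add_mulVec, ← Matrix.mul_assoc, mulVec_mulVec]
  have hPy : ∀ z, y ⬝ᵥ (P *ᵥ z) = (P *ᵥ y) ⬝ᵥ z := fun z => by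
    rw [dotProduct_mulVec, ← mulVec_transpose, hP.eq]
  have hv : ∀ w : Fin m → ℝ, w ⬝ᵥ ((R * gainOf A B R P) *ᵥ y)
      = -((P *ᵥ y) ⬝ᵥ ((A⁻¹ * B) *ᵥ w)) := fun w => by
    rw [h1, neg_mulVec, dotProduct_neg, ← mulVec_mulVec, dotProduct_mulVec, vecMul_transpose,
      dotProduct_comm]
  have hK : y ⬝ᵥ ((Kᵀ * R * gainOf A B R P) *ᵥ y) = (K *ᵥ y) ⬝ᵥ ((R * gainOf A B R P) *ᵥ y) := by
    rw [Matrix.mul_assoc, ← mulVec_mulVec, dotProduct_mulVec, vecMul_transpose]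
  rw [hF, dotProduct_add] at hW
  rw [hK, hv, hv, hPy, hξ, dotProduct_sub]
  linarith

theorem IsTrajectory.intervalIntegrable_deriv_mul_deriv (hx : IsTrajectory A B τ x u) {a b : ℝ}
    (ha : 0 ≤ a) (hab : a ≤ b) (hb : b ≤ τ) (i k : Fin n) :
    IntervalIntegrable (fun t => deriv x t i * deriv x t k) volume a b := by
  rw [intervalIntegrable_iff_integrableOn_Icc_of_le hab]
  exact IntegrableOn.mono_set (s := Set.Icc a b) (t := Set.Icc 0 τ)
    ((hx.memLp_deriv i).integrable_mul (hx.memLp_deriv k)) (Set.Icc_subset_Icc ha hb)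

theorem IsTrajectory.intervalIntegrable_deriv_mul_input (hx : IsTrajectory A B τ x u) {a b : ℝ}
    (ha : 0 ≤ a) (hab : a ≤ b) (hb : b ≤ τ) (i : Fin n) (c : Fin m) :
    IntervalIntegrable (fun t => deriv x t i * u t c) volume a b := by
  rw [intervalIntegrable_iff_integrableOn_Icc_of_le hab]
  exact IntegrableOn.mono_set (s := Set.Icc a b) (t := Set.Icc 0 τ)
    ((hx.memLp_deriv i).integrable_mul (hx.memLp_input c)) (Set.Icc_subset_Icc ha hb)

/-- Translates rows of `Ixx` and `Ixu` into integrals of bilinear forms. As `vec` stacks columns,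
the index `(i, k)` carries the entry `M k i`. -/
theorem intervalIntegrable_bilin {ι κ : Type*} [Fintype ι] [Fintype κ] {f : ℝ → ι → ℝ}
    {g : ℝ → κ → ℝ} {a b : ℝ}
    (h : ∀ i k, IntervalIntegrable (fun t => f t i * g t k) volume a b) (M : Matrix κ ι ℝ) :
    IntervalIntegrable (fun t => g t ⬝ᵥ (M *ᵥ f t)) volume a b ∧
      ∑ q : ι × κ, (∫ t in a..b, f t q.1 * g t q.2) * M.vec q
        = ∫ t in a..b, g t ⬝ᵥ (M *ᵥ f t) := by
  have he : ∀ t, g t ⬝ᵥ (M *ᵥ f t) = ∑ q : ι × κ, f t q.1 * g t q.2 * M.vec q := by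
    intro t
    simp only [dotProduct, mulVec, Finset.mul_sum, Fintype.sum_prod_type, vec]
    rw [Finset.sum_comm]
    exact Finset.sum_congr rfl fun i _ => Finset.sum_congr rfl fun k _ => by ring
  simp only [he]
  have hi : ∀ q : ι × κ, IntervalIntegrable (fun t => f t q.1 * g t q.2 * M.vec q) volume a b :=
    fun q => (h q.1 q.2).mul_const _
  constructor
  · simpa only [Finset.sum_fn] using IntervalIntegrable.sum Finset.univ fun q _ => hi q
  · rw [intervalIntegral.integral_finsetSum fun q _ => hi q]
    simp only [intervalIntegral.integral_mul_const]

/-- Energy balance over one window. -/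
theorem IsTrajectory.value_increment (hx : IsTrajectory A B τ x u) (hA : IsUnit A.det)
    (hR : R.PosDef) {P W : Matrix (Fin n) (Fin n) ℝ}
    (hP : P.IsSymm) {K : Matrix (Fin m) (Fin n) ℝ}
    (h : P * (A⁻¹ * (1 + B * K)) + (A⁻¹ * (1 + B * K))ᵀ * P + W = 0) {a b : ℝ}
    (ha : 0 ≤ a) (hab : a ≤ b) (hb : b ≤ τ) :
    x b ⬝ᵥ (P *ᵥ x b) - x a ⬝ᵥ (P *ᵥ x a) =
      2 * (∫ t in a..b, deriv x t ⬝ᵥ ((Kᵀ * R * gainOf A B R P) *ᵥ deriv x t)) +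
      2 * (∫ t in a..b, u t ⬝ᵥ ((R * gainOf A B R P) *ᵥ deriv x t)) -
      ∫ t in a..b, deriv x t ⬝ᵥ (W *ᵥ deriv x t) := by
  have hac : AbsolutelyContinuousOnInterval x a b := hx.absCont.mono (by
    rw [Set.uIcc_of_le hab, Set.uIcc_of_le (ha.trans (hab.trans hb))]
    exact Set.Icc_subset_Icc ha hb)
  have hxx := intervalIntegrable_bilin (f := deriv x) (g := deriv x)
    (hx.intervalIntegrable_deriv_mul_deriv ha hab hb)
  have hxu := intervalIntegrable_bilin (f := deriv x) (g := u)
    (hx.intervalIntegrable_deriv_mul_input ha hab hb)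
  -- The fundamental theorem of calculus is needed in its absolutely continuous form, since the
  -- differential equation holds only almost everywhere.
  rw [← (absolutelyContinuousOnInterval_form hac P).integral_deriv_eq_sub,
    ← intervalIntegral.integral_const_mul, ← intervalIntegral.integral_const_mul,
    ← intervalIntegral.integral_add ((hxx _).1.const_mul 2) ((hxu _).1.const_mul 2),
    ← intervalIntegral.integral_sub (((hxx _).1.const_mul 2).add ((hxu _).1.const_mul 2))
      (hxx _).1]
  refine intervalIntegral.integral_congr_ae ?_
  have hae := (ae_restrict_iff' measurableSet_Icc).1 hx.hasDerivAt
  filter_upwards [hae] with t ht hmem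
  rw [Set.uIoc_of_le hab] at hmem
  have hd := ht ⟨ha.trans hmem.1.le, hmem.2.trans hb⟩
  rw [(hasDerivAt_form hd hP).deriv, hd.deriv]
  exact value_rate_identity hA hR hP h rfl

end Trajectory

/-! ### The linear system built from the data and its least-squares solution. -/

section LeastSquares

variable {n m : ℕ}

/-- The independent entries of a symmetric matrix. -/
def vech (P : Matrix (Fin n) (Fin n) ℝ) (hP : P.IsSymm) : Sym2 (Fin n) → ℝ :=
  Sym2.lift ⟨fun a b => P a b, fun a b => (hP.apply a b).symm⟩

theorem duplication_mulVec_vech {P : Matrix (Fin n) (Fin n) ℝ} (hP : P.IsSymm) :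
    duplication n *ᵥ vech P hP = P.vec := by
  ext q
  simp only [mulVec, dotProduct, duplication, of_apply, ite_mul, one_mul, zero_mul,
    Finset.sum_ite_eq, Finset.mem_univ, if_true]
  simp only [vech, Sym2.lift_mk, vec]
  exact hP.apply _ _

/-- The vector of unknowns assembled from a symmetric matrix, a vector and a gain. -/
def unknownVec (P : Matrix (Fin n) (Fin n) ℝ) (hP : P.IsSymm) (ε : Fin n → ℝ)
    (K : Matrix (Fin m) (Fin n) ℝ) : Unknown n m → ℝ :=
  Sum.elim (vech P hP) (Sum.elim ε K.vec)

theorem dataMatrix_mulVec (d : Data n m) (R : Matrix (Fin m) (Fin m) ℝ)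
    (K K' : Matrix (Fin m) (Fin n) ℝ) {P : Matrix (Fin n) (Fin n) ℝ} (hP : P.IsSymm)
    (ε : Fin n → ℝ) :
    d.dataMatrix R K *ᵥ unknownVec P hP ε K' =
      d.deltaKappa *ᵥ P.vec + (d.deltaX *ᵥ ε + (-(2 : ℝ) • (d.Ixx *ᵥ (Kᵀ * R * K').vec)
        - (2 : ℝ) • (d.Ixu *ᵥ (R * K').vec))) := by
  rw [Data.dataMatrix, unknownVec, fromCols_mulVec_sumElim, fromCols_mulVec_sumElim,
    ← mulVec_mulVec, duplication_mulVec_vech, sub_mulVec, smul_mulVec, smul_mulVec,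
    ← mulVec_mulVec, ← mulVec_mulVec, kronecker_mulVec_vec, kronecker_mulVec_vec,
    transpose_one, Matrix.mul_one, Matrix.mul_one]

theorem deltaKappa_mulVec_vec (d : Data n m) (P : Matrix (Fin n) (Fin n) ℝ) (j : Fin d.N) :
    (d.deltaKappa *ᵥ P.vec) j =
      d.xbar ((j + 1) * d.T) ⬝ᵥ (P *ᵥ d.xbar ((j + 1) * d.T))
        - d.xbar (j * d.T) ⬝ᵥ (P *ᵥ d.xbar (j * d.T)) := by
  have he : ∀ y : Fin n → ℝ, y ⬝ᵥ (P *ᵥ y) = ∑ q : Fin n × Fin n, y q.1 * y q.2 * P.vec q := by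
    intro y
    simp only [dotProduct, mulVec, Finset.mul_sum, Fintype.sum_prod_type, vec]
    rw [Finset.sum_comm]
    exact Finset.sum_congr rfl fun i _ => Finset.sum_congr rfl fun k _ => by ring
  rw [he, he, ← Finset.sum_sub_distrib]
  simp only [mulVec, dotProduct, Data.deltaKappa, of_apply, Data.xkappa, sub_mul]

/-- With `c` the bias, the choice `ε = -2Pc` cancels all terms linear in `y`. The remaining `cᵀPc`
does not depend on time and disappears from increments. -/
theorem bias_form {P : Matrix (Fin n) (Fin n) ℝ} (hP : P.IsSymm) (y c : Fin n → ℝ) :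
    (y + c) ⬝ᵥ (P *ᵥ (y + c)) + (y + c) ⬝ᵥ (-(2 : ℝ) • (P *ᵥ c)) =
      y ⬝ᵥ (P *ᵥ y) - c ⬝ᵥ (P *ᵥ c) := by
  have h : c ⬝ᵥ (P *ᵥ y) = y ⬝ᵥ (P *ᵥ c) := by
    rw [dotProduct_mulVec, ← mulVec_transpose, hP.eq, dotProduct_comm]
  simp only [mulVec_add, add_dotProduct, dotProduct_add, dotProduct_smul, smul_eq_mul, h]
  ring

variable {N : ℕ} {A : Matrix (Fin n) (Fin n) ℝ} {B : Matrix (Fin n) (Fin m) ℝ}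
  {Q : Matrix (Fin n) (Fin n) ℝ} {R : Matrix (Fin m) (Fin m) ℝ}
  {T : ℝ} {x : ℝ → Fin n → ℝ} {u : ℝ → Fin m → ℝ} {d : Data n m}

/-- Every solution of a Lyapunov equation solves the linear system built from the data. -/
theorem IsTrajectory.dataMatrix_mulVec_eq (hx : IsTrajectory A B (N * T) x u) (hT : 0 < T)
    (xb : Fin n → ℝ) (hd : d = measure N T x u xb) (hA : IsUnit A.det)
    (hR : R.PosDef) {P W : Matrix (Fin n) (Fin n) ℝ} (hP : P.IsSymm)
    {K : Matrix (Fin m) (Fin n) ℝ}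
    (h : P * (A⁻¹ * (1 + B * K)) + (A⁻¹ * (1 + B * K))ᵀ * P + W = 0) :
    d.dataMatrix R K *ᵥ unknownVec P hP (-(2 : ℝ) • (P *ᵥ xb)) (gainOf A B R P) =
      -(d.Ixx *ᵥ W.vec) := by
  subst hd
  rw [dataMatrix_mulVec]
  ext j
  have hj : ((j : ℕ) : ℝ) + 1 ≤ N := by exact_mod_cast (show (j : ℕ) + 1 ≤ N from j.2)
  have ha : 0 ≤ ((j : ℕ) : ℝ) * T := by positivity
  have hab : ((j : ℕ) : ℝ) * T ≤ ((j : ℕ) + 1) * T := by nlinarith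
  have hb : (((j : ℕ) : ℝ) + 1) * T ≤ N * T := by gcongr
  have hxx := intervalIntegrable_bilin (f := deriv x) (g := deriv x)
    (hx.intervalIntegrable_deriv_mul_deriv ha hab hb)
  have hxu := intervalIntegrable_bilin (f := deriv x) (g := u)
    (hx.intervalIntegrable_deriv_mul_input ha hab hb)
  have hIxx : ∀ M : Matrix (Fin n) (Fin n) ℝ, ((measure N T x u xb).Ixx *ᵥ M.vec) j =
      ∫ t in (((j : ℕ) : ℝ) * T)..(((j : ℕ) + 1) * T), deriv x t ⬝ᵥ (M *ᵥ deriv x t) :=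
    fun M => (hxx M).2
  have hIxu : ∀ M : Matrix (Fin m) (Fin n) ℝ, ((measure N T x u xb).Ixu *ᵥ M.vec) j =
      ∫ t in (((j : ℕ) : ℝ) * T)..(((j : ℕ) + 1) * T), u t ⬝ᵥ (M *ᵥ deriv x t) :=
    fun M => (hxu M).2
  have hΔ : ∀ ε : Fin n → ℝ, ((measure N T x u xb).deltaX *ᵥ ε) j =
      (x (((j : ℕ) + 1) * T) + xb) ⬝ᵥ ε - (x ((j : ℕ) * T) + xb) ⬝ᵥ ε :=
    fun ε => sub_dotProduct _ _ ε
  have hκ : ((measure N T x u xb).deltaKappa *ᵥ P.vec) j =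
      (x (((j : ℕ) + 1) * T) + xb) ⬝ᵥ (P *ᵥ (x (((j : ℕ) + 1) * T) + xb))
        - (x ((j : ℕ) * T) + xb) ⬝ᵥ (P *ᵥ (x ((j : ℕ) * T) + xb)) :=
    deltaKappa_mulVec_vec _ P j
  have hV := hx.value_increment hA hR hP h ha hab hb
  have b1 := bias_form hP (x (((j : ℕ) + 1) * T)) xb
  have b2 := bias_form hP (x ((j : ℕ) * T)) xb
  simp only [Pi.add_apply, Pi.sub_apply, Pi.smul_apply, Pi.neg_apply, smul_eq_mul]
  rw [hIxx, hIxx, hIxu, hΔ, hκ]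
  linarith

/-- The system is consistent and `XᵀX` has the rank of `X`, hence is invertible; least squares then
returns the exact solution. -/
theorem leastSquares_eq {K : Matrix (Fin m) (Fin n) ℝ} (hrank : d.FullColumnRank R K)
    {θ : Unknown n m → ℝ} (hθ : d.dataMatrix R K *ᵥ θ = d.rhs Q R K) :
    d.leastSquares Q R K = θ := by
  set X := d.dataMatrix R K with hX
  have hu : IsUnit (Xᵀ * X).det := by
    rw [← Matrix.isUnit_iff_isUnit_det, ← mulVec_injective_iff_isUnit]
    refine mulVec_injective_of_rank_eq_card ?_
    rw [rank_transpose_mul_self]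
    exact hrank
  rw [Data.leastSquares, ← hX, ← hθ, mulVec_mulVec, Matrix.mul_assoc,
    Matrix.nonsing_inv_mul _ hu, one_mulVec]

/-- Symmetric matrices, as a subspace. -/
def symmSubmodule (n : ℕ) : Submodule ℝ (Matrix (Fin n) (Fin n) ℝ) where
  carrier := {P | P.IsSymm}
  add_mem' := fun h₁ h₂ => h₁.add h₂
  zero_mem' := isSymm_zero
  smul_mem' := fun c _ h => h.smul c

/-- A Lyapunov equation is solvable for every symmetric right-hand side if the homogeneous
equation has only the trivial symmetric solution. -/
theorem exists_lyapunov_solution {F : Matrix (Fin n) (Fin n) ℝ}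
    (hF : ∀ P : Matrix (Fin n) (Fin n) ℝ, P.IsSymm → P * F + Fᵀ * P = 0 → P = 0)
    {W : Matrix (Fin n) (Fin n) ℝ} (hW : W.IsSymm) :
    ∃ P : Matrix (Fin n) (Fin n) ℝ, P.IsSymm ∧ P * F + Fᵀ * P + W = 0 := by
  let L : Matrix (Fin n) (Fin n) ℝ →ₗ[ℝ] Matrix (Fin n) (Fin n) ℝ :=
    { toFun := fun P => P * F + Fᵀ * P
      map_add' := fun P P' => by rw [Matrix.add_mul, Matrix.mul_add]; abel
      map_smul' := fun c P => by simp [smul_add] }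
  have hL : ∀ P ∈ symmSubmodule n, L P ∈ symmSubmodule n := by
    intro P hP
    have hP' : Pᵀ = P := hP
    change (P * F + Fᵀ * P)ᵀ = P * F + Fᵀ * P
    rw [transpose_add, transpose_mul, transpose_mul, transpose_transpose, hP', add_comm]
  have hinj : Function.Injective (L.restrict hL) := by
    rw [← LinearMap.ker_eq_bot, LinearMap.ker_eq_bot']
    intro P h
    exact Subtype.ext (hF P P.2 (congrArg Subtype.val h))
  obtain ⟨P, hP⟩ := LinearMap.injective_iff_surjective.1 hinj ⟨-W, (symmSubmodule n).neg_mem hW⟩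
  have h1 : (P : Matrix (Fin n) (Fin n) ℝ) * F + Fᵀ * P = -W := congrArg Subtype.val hP
  exact ⟨P, P.2, by rw [h1, neg_add_cancel]⟩

/-- Applies to any symmetric solution `P`, so it gives uniqueness for the evaluation equation as
well as the value of the estimates. -/
theorem leastSquares_eq_unknownVec (hx : IsTrajectory A B (N * T) x u) (hT : 0 < T)
    (xb : Fin n → ℝ) (hd : d = measure N T x u xb) (hA : IsUnit A.det) (hR : R.PosDef)
    {K : Matrix (Fin m) (Fin n) ℝ} (hrank : d.FullColumnRank R K)
    {P : Matrix (Fin n) (Fin n) ℝ} (hP : P.IsSymm) (h : SolvesEvaluation A B Q R K P) :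
    P = d.Phat Q R K ∧ gainOf A B R P = d.Khat Q R K ∧
      d.epsHat Q R K = -(2 : ℝ) • (P *ᵥ xb) := by
  have hls := leastSquares_eq (Q := Q) hrank
    (hx.dataMatrix_mulVec_eq hT xb hd hA hR hP (W := Q + Kᵀ * R * K) (by rw [← add_assoc]; exact h))
  refine ⟨?_, ?_, ?_⟩
  · ext a b
    simp [Data.Phat, hls, unknownVec, vech]
  · ext c a
    simp [Data.Khat, hls, unknownVec, vec]
  · ext a
    simp [Data.epsHat, hls, unknownVec]

/-- Solvability comes from the data rather than from stability of `K`: a symmetric solution of the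
homogeneous equation yields a null vector of `X(K)` containing its entries, so full column rank
makes it zero. -/
theorem exists_evaluation_solution (hx : IsTrajectory A B (N * T) x u) (hT : 0 < T)
    (xb : Fin n → ℝ) (hd : d = measure N T x u xb) (hA : IsUnit A.det) (hQ : Q.PosSemidef)
    (hR : R.PosDef) {K : Matrix (Fin m) (Fin n) ℝ} (hrank : d.FullColumnRank R K) :
    ∃ P : Matrix (Fin n) (Fin n) ℝ, P.IsSymm ∧ SolvesEvaluation A B Q R K P := by
  obtain ⟨P, hP, h⟩ := exists_lyapunov_solution (F := A⁻¹ * (1 + B * K)) (fun P hP h => by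
      have h1 := hx.dataMatrix_mulVec_eq hT xb hd hA hR hP (W := 0) (K := K) (by rw [add_zero, h])
      rw [vec_zero, mulVec_zero, neg_zero] at h1
      have h2 := mulVec_injective_of_rank_eq_card hrank (h1.trans (mulVec_zero _).symm)
      ext a b
      simpa [unknownVec, vech] using congrFun h2 (Sum.inl s(a, b)))
    (isSymm_of_isHermitian (hQ.add (transpose_mul_mul_posSemidef hR.posSemidef K)).1)
  exact ⟨P, hP, by rw [SolvesEvaluation, add_assoc]; exact h⟩

end LeastSquares

end DFC

/-! ### The main theorem. -/

theorem theorem2 {n m N : ℕ}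
    (A : Matrix (Fin n) (Fin n) ℝ) (B : Matrix (Fin n) (Fin m) ℝ)
    (Q : Matrix (Fin n) (Fin n) ℝ) (R : Matrix (Fin m) (Fin m) ℝ)
    (hA : IsUnit A.det) (hAB : DFC.Controllable A B)
    (hQ : Q.PosSemidef) (hR : R.PosDef) (hQA : DFC.Observable (DFC.psdSqrt Q) A)
    (T : ℝ) (hT : 0 < T)
    (x : ℝ → Fin n → ℝ) (u : ℝ → Fin m → ℝ) (hx : DFC.IsTrajectory A B (N * T) x u)
    (xb : Fin n → ℝ) (d : DFC.Data n m) (hd : d = DFC.measure N T x u xb) :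
    -- One step: least squares returns exactly the solution of the model-based equations.
    (∀ K : Matrix (Fin m) (Fin n) ℝ, d.FullColumnRank R K →
      (∀ (P : Matrix (Fin n) (Fin n) ℝ) (K' : Matrix (Fin m) (Fin n) ℝ),
        (P.IsSymm ∧ DFC.SolvesEvaluation A B Q R K P ∧ K' = DFC.gainOf A B R P) ↔
          (P = d.Phat Q R K ∧ K' = d.Khat Q R K)) ∧
      d.epsHat Q R K = -(2 : ℝ) • (d.Phat Q R K *ᵥ xb) ∧
      (DFC.Stabilizing A B K → (d.Phat Q R K).PosDef)) ∧
    -- Convergence of the data-driven iteration to the optimal value matrix and gain.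
    (∀ K₁ : Matrix (Fin m) (Fin n) ℝ, DFC.Stabilizing A B K₁ →
      (∀ i, d.FullColumnRank R (d.gainSeq Q R K₁ i)) →
      (∀ i, DFC.Stabilizing A B (d.gainSeq Q R K₁ i)) ∧
      ∃ Pstar : Matrix (Fin n) (Fin n) ℝ,
        (Pstar.PosDef ∧ DFC.SolvesARE A B Q R Pstar) ∧
        (∀ P : Matrix (Fin n) (Fin n) ℝ, P.PosDef → DFC.SolvesARE A B Q R P → P = Pstar) ∧
        Tendsto (d.valueSeq Q R K₁) atTop (𝓝 Pstar) ∧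
        Tendsto (d.gainSeq Q R K₁) atTop (𝓝 (DFC.gainOf A B R Pstar))) := by
  -- A model-based solution exists and least squares must equal it, so the estimates inherit its
  -- properties; both halves of the theorem rest on this.
  have hstep : ∀ K : Matrix (Fin m) (Fin n) ℝ, d.FullColumnRank R K →
      (d.Phat Q R K).IsSymm ∧ DFC.SolvesEvaluation A B Q R K (d.Phat Q R K) ∧
        d.Khat Q R K = DFC.gainOf A B R (d.Phat Q R K) ∧
        d.epsHat Q R K = -(2 : ℝ) • (d.Phat Q R K *ᵥ xb) := by
    intro K hK
    obtain ⟨P, hP, h⟩ := DFC.exists_evaluation_solution hx hT xb hd hA hQ hR hK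
    obtain ⟨h1, h2, h3⟩ := DFC.leastSquares_eq_unknownVec hx hT xb hd hA hR hK hP h
    rw [← h1]
    exact ⟨hP, h, h2.symm, h3⟩
  refine ⟨fun K hK => ?_, fun K₁ hK₁ hrank => ?_⟩
  · obtain ⟨h1, h2, h3, h4⟩ := hstep K hK
    refine ⟨fun P K' => ⟨?_, ?_⟩, h4, fun hs => h2.posDef_of_stabilizing hA hQ hR hQA hs h1⟩
    · rintro ⟨hP, h, rfl⟩
      obtain ⟨e1, e2, -⟩ := DFC.leastSquares_eq_unknownVec hx hT xb hd hA hR hK hP h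
      exact ⟨e1, e2⟩
    · rintro ⟨rfl, rfl⟩
      exact ⟨h1, h2, h3⟩
  · exact DFC.policyIteration_tendsto hA hQ hR hQA (P := d.valueSeq Q R K₁)
      (K := d.gainSeq Q R K₁) hK₁ (fun i => (hstep _ (hrank i)).1)
      (fun i => (hstep _ (hrank i)).2.1) (fun i => (hstep _ (hrank i)).2.2.1)
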